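/- Let $\psi:\mathbb{N}=\{1,2,3,\dots\}\to[0,\infty)$ be any nonnegative arithmetical function. For each $n\in\mathbb{N}$ let $\mathcal{E}_n\subseteq\mathbb{R}/\mathbb{Z}$ be the union, over all integers $1\le a\le n$ with $\gcd(a,n)=1$, of the images modulo $1$ of the open intervals $\left(\frac{a-\psi(n)}{n},\frac{a+\psi(n)}{n}\right)$, and let $$W(\psi):=\limsup_{n\to\infty}\mathcal{E}_n=\bigcap_{m=1}^{\infty}\ \bigcup_{n\ge m}\mathcal{E}_n$$ be the set of points of $\mathbb{R}/\mathbb{Z}$ that lie in infinitely many of the sets $\mathcal{E}_n$. If $\sum_{n=1}^{\infty}\psi(n)=\infty$, then the Hausdorff dimension of $W(\psi)$ is equal to $1$. -/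

import Mathlib

namespace DuffinSchaeffer

/-- The set `E_n ⊆ ℝ/ℤ`: the union, over `1 ≤ a ≤ n` with `gcd(a, n) = 1`, of the images modulo `1`
of the open intervals `((a - ψ n) / n, (a + ψ n) / n)`. (For `n = 0` the union is empty.) -/
def E (ψ : ℕ → ℝ) (n : ℕ) : Set UnitAddCircle :=
  ⋃ a ∈ {a : ℕ | 1 ≤ a ∧ a ≤ n ∧ Nat.Coprime a n},
    (fun x : ℝ => (x : UnitAddCircle)) '' Set.Ioo (((a : ℝ) - ψ n) / n) (((a : ℝ) + ψ n) / n)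

/-- `W(ψ) = limsup E_n`, the set of points of `ℝ/ℤ` that lie in infinitely many of the `E_n`. -/
def W (ψ : ℕ → ℝ) : Set UnitAddCircle :=
  ⋂ m ≥ 1, ⋃ n ≥ m, E ψ n

end DuffinSchaeffer

/-! Fix `0 < s < 1`. To see that `W ψ` is not `s`-null, it suffices that no countable cover with
small total weight `∑ d i ^ s` contains it. Nested intervals are built, the successive ones inside
sets `E ψ n` with `n` unbounded, keeping the invariant that the cover sets meeting an interval of
length `L` have total weight at most `L ^ s / 16`. In particular each such set has `d i ≤ L`. As `L
→ 0`, no set with fixed `d i > 0` can meet all the intervals, so their common point lies in `W ψ`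
but outside the cover.

The descent is `exists_child_of_large_values`. Put `t = N ^ ((1 - s) / 16)`. Divergence gives, for
arbitrarily large `N`, a set `Q` of integers in `[N, 2N)` with `ψ q / q ≥ 1 / (#Q * N * t)`
(`exists_finset_large_values`). Reduced fractions with denominators in `Q` number about `#Q * N` up
to powers of `t`. A second moment estimate (`card_pairs_same_cell_le`) shows that they occupy at
least `t ^ (-7) / ρ` cells of side `ρ = 1 / (#Q * N)`. Averaging the cover's weight over these cells
(`exists_hitWeight_le`) gives one of small weight; the gain `ρ ^ (1 - s) ≤ t ^ (-16)` pays for every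
loss.

Averaging fails on cells met by cover sets larger than `ρ`. These are few once every set involved
has `d i ≤ N ^ (-1/2)`, which is why the construction first passes to an intermediate mesh `N ^
(-1/2)`. -/

namespace DuffinSchaeffer

/-! ### Coprime integers and spacing of fractions -/

open Finset in
/-- Legendre's sieve, in the crude form with error `2 ^ #S`. -/
theorem abs_card_sieve_sub_le (S : Finset ℕ) (hS : ∀ p ∈ S, p.Prime) :
    ∀ x y : ℝ, 0 ≤ x → x ≤ y →
      |(#{a ∈ Ioc ⌊x⌋₊ ⌊y⌋₊ | ∀ p ∈ S, ¬ p ∣ a} : ℝ) - (y - x) * ∏ p ∈ S, (1 - 1 / (p : ℝ))|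
        ≤ 2 ^ #S := by
  induction S using Finset.induction_on with
  | empty =>
    intro x y hx hxy
    have h1 : ⌊x⌋₊ ≤ ⌊y⌋₊ := Nat.floor_le_floor hxy
    simp only [notMem_empty, IsEmpty.forall_iff, implies_true, filter_true, Nat.card_Ioc,
      prod_empty, card_empty, pow_zero, mul_one]
    rw [Nat.cast_sub h1, abs_le]
    have := Nat.floor_le hx
    have := Nat.floor_le (hx.trans hxy)
    have := Nat.lt_floor_add_one x
    have := Nat.lt_floor_add_one y
    constructor <;> linarith
  | insert p S hpS ih =>
    intro x y hx hxy
    have hp : p.Prime := hS p (mem_insert_self _ _)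
    have hp0 : (0 : ℝ) < p := by exact_mod_cast hp.pos
    have ih := ih fun r hr => hS r (mem_insert_of_mem hr)
    have h1 := ih x y hx hxy
    have h2 := ih (x / p) (y / p) (by positivity) (by gcongr)
    -- The multiples of `p` in `(x, y]` are the `p * b` with `b ∈ (x / p, y / p]`. The induction
    -- hypothesis covers both ranges, so the error doubles with each prime.
    have hcard : #{a ∈ Ioc ⌊x⌋₊ ⌊y⌋₊ | ∀ r ∈ S, ¬ r ∣ a} =
        #{a ∈ Ioc ⌊x⌋₊ ⌊y⌋₊ | ∀ r ∈ insert p S, ¬ r ∣ a} +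
          #{a ∈ Ioc ⌊x / p⌋₊ ⌊y / p⌋₊ | ∀ r ∈ S, ¬ r ∣ a} := by
      rw [← card_filter_add_card_filter_not (s := {a ∈ Ioc ⌊x⌋₊ ⌊y⌋₊ | ∀ r ∈ S, ¬ r ∣ a})
        (fun a => ¬ p ∣ a)]
      congr 1
      · rw [filter_filter]
        congr 1
        ext a
        simp [and_comm]
      · symm
        refine card_bij (fun b _ => p * b) ?_ ?_ ?_
        · intro b hb
          simp only [mem_filter, mem_Ioc, Nat.floor_lt (show 0 ≤ x / p by positivity),
            Nat.le_floor_iff (show 0 ≤ y / p from div_nonneg (hx.trans hxy) hp0.le),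
            Nat.floor_lt hx, Nat.le_floor_iff (hx.trans hxy), div_lt_iff₀ hp0,
            le_div_iff₀ hp0] at hb ⊢
          obtain ⟨⟨hb1, hb2⟩, hb3⟩ := hb
          refine ⟨⟨⟨?_, ?_⟩, ?_⟩, by simp⟩
          · push_cast; linarith
          · push_cast; linarith
          · intro r hr hd
            rcases ((hS r (mem_insert_of_mem hr)).dvd_mul).1 hd with h | h
            · rw [Nat.prime_dvd_prime_iff_eq (hS r (mem_insert_of_mem hr)) hp] at h
              exact hpS (h ▸ hr)
            · exact hb3 r hr h
        · intro b _ c _ h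
          exact Nat.eq_of_mul_eq_mul_left hp.pos h
        · intro a ha
          simp only [mem_filter, mem_Ioc, not_not, Nat.floor_lt hx,
            Nat.le_floor_iff (hx.trans hxy)] at ha
          obtain ⟨⟨⟨h1, h2⟩, h3⟩, b, rfl⟩ := ha
          refine ⟨b, ?_, rfl⟩
          simp only [mem_filter, mem_Ioc, Nat.floor_lt (show 0 ≤ x / p by positivity),
            Nat.le_floor_iff (show 0 ≤ y / p from div_nonneg (hx.trans hxy) hp0.le),
            div_lt_iff₀ hp0, le_div_iff₀ hp0]
          push_cast at h1 h2
          exact ⟨⟨by linarith, by linarith⟩, fun r hr hd => h3 r hr (hd.mul_left p)⟩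
    rw [prod_insert hpS, card_insert_of_notMem hpS, pow_succ]
    have hcard' := congrArg (Nat.cast (R := ℝ)) hcard
    push_cast at hcard'
    set Z := ∏ r ∈ S, (1 - 1 / (r : ℝ))
    have e : (y - x) * ((1 - 1 / (p : ℝ)) * Z) = (y - x) * Z - (y / p - x / p) * Z := by
      field_simp
    rw [e]
    rw [abs_le] at h1 h2 ⊢
    constructor <;> linarith

open Finset in
/-- A lower bound for the number of integers in `(x, y]` that are coprime to `q`. -/
theorem le_card_coprime (q : ℕ) (hq : q ≠ 0) (x y : ℝ) (hx : 0 ≤ x) (hxy : x ≤ y) :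
    (y - x) / 2 ^ #q.primeFactors - 2 ^ #q.primeFactors ≤
      (#{a ∈ Ioc ⌊x⌋₊ ⌊y⌋₊ | Nat.Coprime a q} : ℝ) := by
  have h := abs_card_sieve_sub_le q.primeFactors (fun p hp => Nat.prime_of_mem_primeFactors hp)
    x y hx hxy
  have e : ∀ a : ℕ, Nat.Coprime a q ↔ ∀ p ∈ q.primeFactors, ¬ p ∣ a := by
    intro a
    rw [Nat.coprime_iff_isRelPrime, ← not_iff_not, ← Nat.coprime_iff_isRelPrime,
      Nat.Prime.not_coprime_iff_dvd]
    push Not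
    constructor
    · rintro ⟨p, hp, h1, h2⟩
      exact ⟨p, Nat.mem_primeFactors.2 ⟨hp, h2, hq⟩, h1⟩
    · rintro ⟨p, hp, h1⟩
      exact ⟨p, Nat.prime_of_mem_primeFactors hp, h1, Nat.dvd_of_mem_primeFactors hp⟩
  simp_rw [e]
  -- Each Euler factor is at least `1 / 2`; this loss is harmless since `2 ^ #q.primeFactors` is `q
  -- ^ o(1)`.
  have hprod : (1 / 2 : ℝ) ^ #q.primeFactors ≤ ∏ p ∈ q.primeFactors, (1 - 1 / (p : ℝ)) := by
    rw [← prod_const]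
    refine prod_le_prod (fun _ _ => by norm_num) fun p hp => ?_
    have h2 : (2 : ℝ) ≤ p := by exact_mod_cast (Nat.prime_of_mem_primeFactors hp).two_le
    have : 1 / (p : ℝ) ≤ 1 / 2 := by gcongr
    linarith
  have h3 := mul_le_mul_of_nonneg_left hprod (sub_nonneg.2 hxy)
  rw [one_div, inv_pow, ← div_eq_mul_inv] at h3
  rw [abs_le] at h
  linarith [h.1]

-- A prime `p ≥ 2 ^ (1 / δ)` satisfies `2 ≤ p ^ δ`; the fewer than `B` smaller primes are absorbed
-- in the constant `2 ^ B`.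
open Finset in
theorem exists_two_pow_card_primeFactors_le {δ : ℝ} (hδ : 0 < δ) :
    ∃ C : ℝ, 0 < C ∧ ∀ q : ℕ, q ≠ 0 → (2 : ℝ) ^ #q.primeFactors ≤ C * (q : ℝ) ^ δ := by
  obtain ⟨B, hB⟩ := exists_nat_ge ((2 : ℝ) ^ (1 / δ))
  refine ⟨2 ^ B, by positivity, fun q hq => ?_⟩
  have hle : ∀ p ∈ q.primeFactors, (2 : ℝ) ≤ (if p < B then 2 else 1) * (p : ℝ) ^ δ := by
    intro p hp
    have hp1 : (1 : ℝ) ≤ p := by exact_mod_cast (Nat.prime_of_mem_primeFactors hp).one_le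
    split_ifs with h
    · have := Real.one_le_rpow hp1 hδ.le
      linarith
    · have h1 : (2 : ℝ) ^ (1 / δ) ≤ p := hB.trans (by exact_mod_cast not_lt.1 h)
      have h2 := Real.rpow_le_rpow (by positivity) h1 hδ.le
      rw [← Real.rpow_mul (by norm_num), one_div_mul_cancel hδ.ne', Real.rpow_one] at h2
      linarith
  calc (2 : ℝ) ^ #q.primeFactors = ∏ _p ∈ q.primeFactors, (2 : ℝ) := by rw [prod_const]
    _ ≤ ∏ p ∈ q.primeFactors, ((if p < B then 2 else 1) * (p : ℝ) ^ δ) :=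
        prod_le_prod (fun _ _ => by norm_num) hle
    _ = (∏ p ∈ q.primeFactors, (if p < B then (2 : ℝ) else 1)) *
          (∏ p ∈ q.primeFactors, (p : ℝ) ^ δ) := prod_mul_distrib
    _ ≤ 2 ^ B * (q : ℝ) ^ δ := by
        gcongr
        · rw [← prod_filter, prod_const]
          refine pow_le_pow_right₀ (by norm_num) ?_
          calc #{a ∈ q.primeFactors | a < B} ≤ #(range B) :=
                card_le_card fun a ha => by simpa using (mem_filter.1 ha).2
            _ = B := card_range B
        · rw [Real.finsetProd_rpow _ _ (fun _ _ => by positivity)]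
          refine Real.rpow_le_rpow (by positivity) ?_ hδ.le
          rw [← Nat.cast_prod]
          exact Nat.cast_le.2 (Nat.le_of_dvd (Nat.pos_of_ne_zero hq) (Nat.prod_primeFactors_dvd q))

open Finset in
/-- The number of pairs of fractions `a / q`, `b / r` that are distinct but close. -/
theorem card_close_pairs_le (q r H : ℕ) (hq : 0 < q) :
    #{x ∈ Icc 1 q ×ˢ Icc 1 r | (x.1 * r - x.2 * q : ℤ) ≠ 0 ∧ |(x.1 * r - x.2 * q : ℤ)| ≤ H}
      ≤ 2 * H := by
  set g := Nat.gcd q r with hg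
  have hg0 : 0 < g := Nat.gcd_pos_of_pos_left _ hq
  obtain ⟨u, hu⟩ : g ∣ q := Nat.gcd_dvd_left q r
  obtain ⟨v, hv⟩ : g ∣ r := Nat.gcd_dvd_right q r
  have hu0 : 0 < u := by
    rcases Nat.eq_zero_or_pos u with h | h
    · simp [h] at hu; omega
    · exact h
  have huv : Nat.Coprime u v := by
    have := Nat.coprime_div_gcd_div_gcd (m := q) (n := r) hg0
    rwa [← hg, hu, hv, Nat.mul_div_cancel_left _ hg0, Nat.mul_div_cancel_left _ hg0] at this
  have hfac : ∀ a b : ℕ, (a * r - b * q : ℤ) = g * (a * v - b * u) := by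
    intro a b; rw [hu, hv]; push_cast; ring
  -- With `q = g * u` and `r = g * v`, the nonzero integer `a * v - b * u` has size at most `H / g`
  -- and determines `a` modulo `u`. The quotient `(a - 1) / u` then tells which of the `g` residue
  -- blocks of `[1, g * u]` contains `a`.
  calc _ ≤ #(((Icc (-((H / g : ℕ) : ℤ)) (H / g : ℕ)).erase 0) ×ˢ range g) := by
        refine card_le_card_of_injOn
          (fun x => ((x.1 * v - x.2 * u : ℤ), (x.1 - 1) / u)) ?_ ?_
        · rintro ⟨a, b⟩ hx
          simp only [coe_filter, mem_product, mem_Icc, Set.mem_ofPred_eq] at hx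
          obtain ⟨⟨⟨ha1, ha2⟩, hb1, hb2⟩, h0, hH⟩ := hx
          rw [hfac] at h0 hH
          simp only [coe_product, coe_erase, coe_range, Set.mem_prod, Set.mem_sdiff,
            Set.mem_singleton_iff, coe_Icc, Set.mem_Icc, Set.mem_Iio]
          refine ⟨⟨?_, right_ne_zero_of_mul h0⟩, ?_⟩
          · rw [← abs_le]
            push_cast
            rw [Int.le_ediv_iff_mul_le (by exact_mod_cast hg0)]
            rw [abs_mul, Nat.abs_cast] at hH
            linarith
          · rw [Nat.div_lt_iff_lt_mul hu0, ← hu]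
            omega
        · rintro ⟨a, b⟩ hx ⟨c, d⟩ hy h
          simp only [coe_filter, mem_product, mem_Icc, Set.mem_ofPred_eq] at hx hy
          simp only [Prod.mk.injEq] at h ⊢
          obtain ⟨h1, h2⟩ := h
          have hd : (u : ℤ) ∣ (a - c : ℤ) := by
            refine IsCoprime.dvd_of_dvd_mul_right (Nat.isCoprime_iff_coprime.2 huv) (z := (v : ℤ)) ?_
            exact ⟨b - d, by linear_combination h1⟩
          have hac : a = c := by
            have hm : (a - 1) % u = (c - 1) % u := by
              refine (Nat.modEq_iff_dvd.2 ?_ : a - 1 ≡ c - 1 [MOD u])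
              rw [Nat.cast_sub hy.1.1.1, Nat.cast_sub hx.1.1.1]
              obtain ⟨k, hk⟩ := hd
              exact ⟨-k, by linear_combination -hk⟩
            have e1 := Nat.div_add_mod (a - 1) u
            have e2 := Nat.div_add_mod (c - 1) u
            rw [h2, hm, e2] at e1
            have := hx.1.1.1
            have := hy.1.1.1
            omega
          refine ⟨hac, ?_⟩
          subst hac
          have : (b : ℤ) * u = d * u := by linarith
          exact_mod_cast mul_right_cancel₀ (by exact_mod_cast hu0.ne') this
    _ = (2 * (H / g)) * g := by
        rw [card_product, card_range, card_erase_of_mem (by simp; positivity), Int.card_Icc]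
        congr 1
        omega
    _ ≤ 2 * H := by
        rw [mul_assoc]
        exact Nat.mul_le_mul_left 2 (Nat.div_mul_le_self H g)

/-! ### Dyadic pigeonholing of the divergent series -/

open Finset in
theorem le_sum_dyadic_levels (J : ℕ) {y : ℝ} (hy : y < 2) :
    y ≤ ∑ j ∈ range (J + 1), (if (1 / 2 : ℝ) ^ j ≤ y then (1 / 2 : ℝ) ^ j else 0)
      + (1 / 2) ^ J := by
  induction J with
  | zero =>
    simp only [zero_add, range_one, sum_singleton, pow_zero]
    split_ifs <;> linarith
  | succ J ih =>
    rw [sum_range_succ]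
    split_ifs with h
    · rw [pow_succ]; linarith
    · have : 0 ≤ ∑ j ∈ range (J + 1), (if (1 / 2 : ℝ) ^ j ≤ y then (1 / 2 : ℝ) ^ j else 0) :=
        sum_nonneg fun j _ => by split_ifs <;> positivity
      linarith

open Finset in
/-- If `∑ ψ` diverges, some dyadic block contains many integers where `ψ` is large. -/
theorem exists_finset_large_values (ψ : ℕ → ℝ)
    (hdiv : Filter.Tendsto (fun N : ℕ => ∑ n ∈ Icc 1 N, ψ n) Filter.atTop Filter.atTop)
    {δ : ℝ} (hδ : 0 < δ) (m : ℕ) :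
    ∃ N ≥ m, 1 ≤ N ∧ ∃ Q : Finset ℕ, Q.Nonempty ∧ Q ⊆ Ico N (2 * N) ∧
      ∀ q ∈ Q, 1 / (#Q * N * (N : ℝ) ^ δ) ≤ ψ q / q := by
  by_contra! hcon
  -- Singletons `Q = {n}` already bound `ψ`, so only the levels `2 ^ (-j)` with `j ≥ 0` are needed
  -- below.
  have hlt : ∀ n, m ≤ n → 1 ≤ n → ψ n < 1 := by
    intro n hn hn1
    obtain ⟨q, hq, h⟩ := hcon n hn hn1 {n} (singleton_nonempty n) (by simp; omega)
    rw [mem_singleton] at hq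
    subst hq
    have hn0 : (0 : ℝ) < q := by exact_mod_cast hn1
    have h1 : (1 : ℝ) ≤ (q : ℝ) ^ δ := Real.one_le_rpow (by exact_mod_cast hn1) hδ.le
    rw [card_singleton, Nat.cast_one, one_mul, div_lt_iff₀ hn0] at h
    refine h.trans_le ?_
    rw [div_mul_eq_mul_div, one_mul, div_le_one (by positivity)]
    nlinarith
  have hlevel : ∀ k j : ℕ, m ≤ 2 ^ k →
      (#{n ∈ Ico (2 ^ k) (2 ^ (k + 1)) | (1 / 2 : ℝ) ^ j ≤ ψ n} : ℝ) * (1 / 2) ^ j ≤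
        2 * ((1 / 2 : ℝ) ^ δ) ^ k := by
    intro k j hk
    set Q := {n ∈ Ico (2 ^ k) (2 ^ (k + 1)) | (1 / 2 : ℝ) ^ j ≤ ψ n} with hQ
    rcases Q.eq_empty_or_nonempty with he | hne
    · rw [he]; simp; positivity
    · obtain ⟨q, hq, h⟩ := hcon (2 ^ k) hk Nat.one_le_two_pow Q hne
        (by rw [← pow_succ']; exact filter_subset _ _)
      have hq' := (mem_filter.1 hq)
      rw [mem_Ico] at hq'
      have hq0 : (0 : ℝ) < q := by exact_mod_cast (Nat.two_pow_pos k).trans_le hq'.1.1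
      have hq2 : (q : ℝ) ≤ 2 * 2 ^ k := by
        rw [← pow_succ']; exact_mod_cast hq'.1.2.le
      have hc : (0 : ℝ) < #Q := by exact_mod_cast hne.card_pos
      have e : ((1 / 2 : ℝ) ^ δ) ^ k = 1 / ((2 : ℝ) ^ k) ^ δ := by
        rw [← Real.rpow_natCast, ← Real.rpow_natCast, ← Real.rpow_mul (by norm_num),
          ← Real.rpow_mul (by norm_num), mul_comm, one_div, Real.inv_rpow (by norm_num), one_div]
      rw [e]
      push_cast at h
      have hT : (0 : ℝ) < ((2 : ℝ) ^ k) ^ δ := by positivity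
      have h2k : (0 : ℝ) < (2 : ℝ) ^ k := by positivity
      rw [div_lt_div_iff₀ hq0 (by positivity)] at h
      rw [mul_one_div, le_div_iff₀ hT]
      have h3 : (1 / 2 : ℝ) ^ j * (#Q * 2 ^ k * ((2 : ℝ) ^ k) ^ δ) ≤ 2 * 2 ^ k :=
        calc _ ≤ ψ q * (#Q * 2 ^ k * ((2 : ℝ) ^ k) ^ δ) := by gcongr; exact hq'.2
          _ ≤ _ := by linarith
      refine le_of_mul_le_mul_right ?_ h2k
      linarith
  -- Truncating at level `2k` costs at most `4 ^ (-k)` for each of the `2 ^ k` terms. The remaining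
  -- `2k + 1` levels are each geometrically small, so the block sums are summable, against
  -- divergence.
  have hblock : ∀ k : ℕ, m ≤ 2 ^ k → ∑ n ∈ Ico (2 ^ k) (2 ^ (k + 1)), ψ n ≤
      ((2 * k + 1 : ℕ) : ℝ) * (2 * ((1 / 2 : ℝ) ^ δ) ^ k) + (1 / 2) ^ k := by
    intro k hk
    calc ∑ n ∈ Ico (2 ^ k) (2 ^ (k + 1)), ψ n
        ≤ ∑ n ∈ Ico (2 ^ k) (2 ^ (k + 1)),
          (∑ j ∈ range (2 * k + 1), (if (1 / 2 : ℝ) ^ j ≤ ψ n then (1 / 2 : ℝ) ^ j else 0)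
            + (1 / 2) ^ (2 * k)) := by
          refine sum_le_sum fun n hn => le_sum_dyadic_levels _ ?_
          rw [mem_Ico] at hn
          have := hlt n (hk.trans hn.1) (Nat.one_le_two_pow.trans hn.1)
          linarith
      _ = ∑ j ∈ range (2 * k + 1),
            (#{n ∈ Ico (2 ^ k) (2 ^ (k + 1)) | (1 / 2 : ℝ) ^ j ≤ ψ n} : ℝ) * (1 / 2) ^ j
            + (1 / 2) ^ k := by
          rw [sum_add_distrib, sum_comm]
          congr 1
          · refine sum_congr rfl fun j _ => ?_
            rw [← sum_filter, sum_const, nsmul_eq_mul]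
          · rw [sum_const, Nat.card_Ico, nsmul_eq_mul, two_mul]
            have : ((2 ^ (k + 1) - 2 ^ k : ℕ) : ℝ) = 2 ^ k := by
              rw [pow_succ, Nat.mul_two, Nat.add_sub_cancel]; push_cast; rfl
            rw [this, pow_add, ← mul_assoc, ← mul_pow]; norm_num
      _ ≤ ∑ _j ∈ range (2 * k + 1), 2 * ((1 / 2 : ℝ) ^ δ) ^ k + (1 / 2) ^ k := by
          gcongr ?_ + _
          exact sum_le_sum fun j _ => hlevel k j hk
      _ = _ := by rw [sum_const, card_range, nsmul_eq_mul]
  set r := (1 / 2 : ℝ) ^ δ with hr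
  have hr0 : 0 < r := by positivity
  have hr1 : r < 1 := Real.rpow_lt_one (by norm_num) (by norm_num) hδ
  set f : ℕ → ℝ := fun k => ((2 * k + 1 : ℕ) : ℝ) * (2 * r ^ k) + (1 / 2) ^ k with hf
  have hf0 : ∀ k, 0 ≤ f k := fun k => by positivity
  have hfs : Summable f := by
    have h1 : Summable fun k : ℕ => (k : ℝ) ^ 1 * r ^ k :=
      summable_pow_mul_geometric_of_norm_lt_one 1 (by rwa [Real.norm_of_nonneg hr0.le])
    have h2 : Summable fun k : ℕ => r ^ k := summable_geometric_of_lt_one hr0.le hr1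
    have h3 : Summable fun k : ℕ => (1 / 2 : ℝ) ^ k :=
      summable_geometric_of_lt_one (by norm_num) (by norm_num)
    refine (((h1.mul_left 4).add (h2.mul_left 2)).add h3).congr fun k => ?_
    simp only [hf]; push_cast; ring
  have hm : m ≤ 2 ^ m := Nat.lt_two_pow_self.le
  have hsum : ∀ K, m ≤ K → ∑ n ∈ Ico (2 ^ m) (2 ^ K), ψ n ≤ ∑ k ∈ Ico m K, f k := by
    intro K hK
    induction K, hK using Nat.le_induction with
    | base => simp
    | succ K hK ih =>
      rw [← sum_Ico_consecutive _ (Nat.pow_le_pow_right (by norm_num) hK)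
        (Nat.pow_le_pow_right (by norm_num) K.le_succ), sum_Ico_succ_top hK]
      exact add_le_add ih (hblock K (hm.trans (Nat.pow_le_pow_right (by norm_num) hK)))
  have htend : Filter.Tendsto (fun K : ℕ => 2 ^ K - 1) Filter.atTop Filter.atTop :=
    Filter.tendsto_atTop_mono (fun K => Nat.le_sub_one_of_lt Nat.lt_two_pow_self)
      Filter.tendsto_id
  obtain ⟨K, hK1, hK2⟩ := (((hdiv.comp htend).eventually_gt_atTop
    (∑ n ∈ Ico 1 (2 ^ m), ψ n + ∑' k, f k)).and (Filter.eventually_ge_atTop m)).exists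
  have e : Icc 1 (2 ^ K - 1) = Ico 1 (2 ^ K) := by
    ext n
    have := Nat.two_pow_pos K
    simp only [mem_Icc, mem_Ico]; omega
  simp only [Function.comp_apply, e] at hK1
  rw [← sum_Ico_consecutive _ Nat.one_le_two_pow
    (Nat.pow_le_pow_right (by norm_num) hK2)] at hK1
  have := hsum K hK2
  have := hfs.sum_le_tsum (Ico m K) fun k _ => hf0 k
  linarith

/-! ### Weighted covers and averaging over cells -/

/-- The total weight of the sets `U i` that meet `A`. -/
noncomputable def hitWeight (U : ℕ → Set ℝ) (w : ℕ → ℝ) (A : Set ℝ) : ℝ :=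
  ∑' i, {i | (U i ∩ A).Nonempty}.indicator w i

section
variable {U : ℕ → Set ℝ} {w : ℕ → ℝ} {A : Set ℝ}

theorem le_hitWeight (hw : ∀ i, 0 ≤ w i) (hs : Summable w) {i : ℕ} (hi : (U i ∩ A).Nonempty) :
    w i ≤ hitWeight U w A := by
  have h := (hs.indicator {i | (U i ∩ A).Nonempty}).le_tsum i
    fun j _ => Set.indicator_nonneg (fun j _ => hw j) j
  rwa [Set.indicator_of_mem (show i ∈ {i | (U i ∩ A).Nonempty} from hi)] at h

theorem sum_le_hitWeight (hw : ∀ i, 0 ≤ w i) (hs : Summable w) {T : Finset ℕ}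
    (hT : ∀ i ∈ T, (U i ∩ A).Nonempty) : ∑ i ∈ T, w i ≤ hitWeight U w A := by
  have h := (hs.indicator {i | (U i ∩ A).Nonempty}).sum_le_tsum T
    fun j _ => Set.indicator_nonneg (fun j _ => hw j) j
  refine le_trans (Finset.sum_le_sum fun i hi => ?_) h
  rw [Set.indicator_of_mem (show i ∈ {i | (U i ∩ A).Nonempty} from hT i hi)]

theorem hitWeight_nonneg (hw : ∀ i, 0 ≤ w i) : 0 ≤ hitWeight U w A :=
  tsum_nonneg fun j => Set.indicator_nonneg (fun j _ => hw j) j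

theorem hitWeight_le_tsum (hw : ∀ i, 0 ≤ w i) (hs : Summable w) :
    hitWeight U w A ≤ ∑' i, w i :=
  (hs.indicator _).tsum_le_tsum (fun i => Set.indicator_le_self' (fun _ _ => hw i) i) hs

end

open Finset in
theorem card_le_of_forall_sub_le (S : Finset ℤ) (B : ℝ) (hB : 0 ≤ B)
    (h : ∀ c ∈ S, ∀ c' ∈ S, ((c' - c : ℤ) : ℝ) ≤ B) : (#S : ℝ) ≤ B + 1 := by
  rcases S.eq_empty_or_nonempty with rfl | hne
  · simp; linarith
  · have h1 := h _ (S.min'_mem hne) _ (S.max'_mem hne)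
    have h2 : S ⊆ Icc (S.min' hne) (S.max' hne) := fun c hc =>
      mem_Icc.2 ⟨S.min'_le c hc, S.le_max' c hc⟩
    have h3 := card_le_card h2
    rw [Int.card_Icc] at h3
    have h4 : S.min' hne ≤ S.max' hne := S.min'_le _ (S.max'_mem hne)
    have h5 : (#S : ℤ) ≤ S.max' hne - S.min' hne + 1 := by omega
    have h6 : (#S : ℝ) ≤ ((S.max' hne - S.min' hne : ℤ) : ℝ) + 1 := by exact_mod_cast h5
    linarith

open Finset Classical in
/-- A set of diameter at most `d` meets at most `d / ρ + 3` sets attached to distinct cells of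
side `ρ`. -/
theorem card_meet_le (V : Set ℝ) (d ρ : ℝ) (hd : 0 ≤ d) (hρ : 0 < ρ)
    (hV : ∀ x ∈ V, ∀ y ∈ V, |x - y| ≤ d) (C : Finset ℤ) (A : ℤ → Set ℝ)
    (hA : ∀ c ∈ C, A c ⊆ Set.Ico (c * ρ) ((c + 2) * ρ)) :
    (#{c ∈ C | (V ∩ A c).Nonempty} : ℝ) ≤ d / ρ + 3 := by
  have := card_le_of_forall_sub_le {c ∈ C | (V ∩ A c).Nonempty} (d / ρ + 2) (by positivity) ?_
  · linarith
  intro c hc c' hc'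
  rw [mem_filter] at hc hc'
  obtain ⟨hc, y, hyV, hyA⟩ := hc
  obtain ⟨hc', z, hzV, hzA⟩ := hc'
  have h1 := hA c hc hyA
  have h2 := hA c' hc' hzA
  have h3 := (abs_le.1 (hV z hzV y hyV)).2
  rw [Set.mem_Ico] at h1 h2
  rw [← sub_le_iff_le_add, le_div_iff₀ hρ]
  push_cast
  nlinarith

/-- Data of a countable cover with `s`-weights: sets `U i` of diameter at most `d i`. -/
structure WeightedCover (s : ℝ) (U : ℕ → Set ℝ) (d : ℕ → ℝ) : Prop where
  pos : ∀ i, 0 < d i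
  summable : Summable fun i => d i ^ s
  dist_le : ∀ i, ∀ x ∈ U i, ∀ y ∈ U i, |x - y| ≤ d i

namespace WeightedCover
variable {s : ℝ} {U : ℕ → Set ℝ} {d : ℕ → ℝ}

theorem weight_nonneg (hU : WeightedCover s U d) (i : ℕ) : 0 ≤ d i ^ s :=
  Real.rpow_nonneg (hU.pos i).le s

theorem le_of_hitWeight_le (hU : WeightedCover s U d) (hs : 0 < s) {A : Set ℝ} {D : ℝ}
    (hD : 0 ≤ D) (h : hitWeight U (fun i => d i ^ s) A ≤ D ^ s) {i : ℕ}
    (hi : (U i ∩ A).Nonempty) : d i ≤ D := by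
  have := (le_hitWeight hU.weight_nonneg hU.summable hi).trans h
  exact (Real.rpow_le_rpow_iff (hU.pos i).le hD hs).1 this

open Finset Classical in
/-- Few cells are met by large sets of the cover. -/
theorem card_met_by_large_le (hU : WeightedCover s U d) (hs1 : s < 1)
    (ρ D : ℝ) (hρ : 0 < ρ) (hD : 0 < D) (C : Finset ℤ) (A : ℤ → Set ℝ) (I : Set ℝ)
    (hA : ∀ c ∈ C, A c ⊆ Set.Ico (c * ρ) ((c + 2) * ρ)) (hAI : ∀ c ∈ C, A c ⊆ I)
    (hdD : ∀ c ∈ C, ∀ i, (U i ∩ A c).Nonempty → d i ≤ D) :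
    (#{c ∈ C | ∃ i, ρ ≤ d i ∧ (U i ∩ A c).Nonempty} : ℝ) ≤
      4 * hitWeight U (fun i => d i ^ s) I * D ^ (1 - s) / ρ := by
  set B := {c ∈ C | ∃ i, ρ ≤ d i ∧ (U i ∩ A c).Nonempty} with hB
  have hch : ∀ c : ℤ, ∃ i, c ∈ B → ρ ≤ d i ∧ (U i ∩ A c).Nonempty := by
    intro c
    by_cases hc : c ∈ B
    · obtain ⟨i, hi⟩ := (mem_filter.1 hc).2
      exact ⟨i, fun _ => hi⟩
    · exact ⟨0, fun h => absurd h hc⟩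
  choose g hg using hch
  have hBC : ∀ c ∈ B, c ∈ C := fun c hc => (mem_filter.1 hc).1
  -- A set with `ρ ≤ d i ≤ D` meets at most `d i / ρ + 3 ≤ 4 * d i / ρ` cells, and `d i ≤ d i ^ s *
  -- D ^ (1 - s)` converts this count into weight.
  have hterm : ∀ i ∈ B.image g, (#{c ∈ B | g c = i} : ℝ) ≤ d i ^ s * (4 * D ^ (1 - s) / ρ) := by
    intro i hi
    obtain ⟨c, hc, rfl⟩ := mem_image.1 hi
    obtain ⟨h1, h2⟩ := hg c hc
    have h3 : (#{c' ∈ B | g c' = g c} : ℝ) ≤ d (g c) / ρ + 3 := by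
      refine le_trans ?_ (card_meet_le (U (g c)) (d (g c)) ρ (hU.pos _).le hρ (hU.dist_le _) C A hA)
      refine Nat.cast_le.2 (card_le_card fun c' hc' => ?_)
      rw [mem_filter] at hc' ⊢
      exact ⟨hBC _ hc'.1, hc'.2 ▸ (hg c' hc'.1).2⟩
    have h4 : d (g c) ≤ d (g c) ^ s * D ^ (1 - s) := by
      calc d (g c) = d (g c) ^ s * d (g c) ^ (1 - s) := by
            rw [← Real.rpow_add (hU.pos _)]; simp
        _ ≤ _ := by
            have := hU.weight_nonneg (g c)
            have := (hU.pos (g c)).le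
            gcongr
            exact hdD c (hBC c hc) _ h2
    have h5 : 1 ≤ d (g c) / ρ := by rwa [one_le_div hρ]
    calc _ ≤ 4 * (d (g c) / ρ) := by linarith
      _ ≤ 4 * ((d (g c) ^ s * D ^ (1 - s)) / ρ) := by gcongr
      _ = _ := by ring
  calc (#B : ℝ) = ∑ i ∈ B.image g, (#{c ∈ B | g c = i} : ℝ) := by
        rw [card_eq_sum_card_image g B]; push_cast; rfl
    _ ≤ ∑ i ∈ B.image g, d i ^ s * (4 * D ^ (1 - s) / ρ) := sum_le_sum hterm
    _ = (∑ i ∈ B.image g, d i ^ s) * (4 * D ^ (1 - s) / ρ) := by rw [sum_mul]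
    _ ≤ hitWeight U (fun i => d i ^ s) I * (4 * D ^ (1 - s) / ρ) := by
        gcongr
        refine sum_le_hitWeight hU.weight_nonneg hU.summable fun i hi => ?_
        obtain ⟨c, hc, rfl⟩ := mem_image.1 hi
        exact (hg c hc).2.mono (Set.inter_subset_inter_right _ (hAI c (hBC c hc)))
    _ = _ := by ring

open Finset Classical in
/-- Among many cells there is one whose set meets only a small part of the cover. -/
theorem exists_hitWeight_le (hU : WeightedCover s U d) (hs1 : s < 1)
    (ρ D : ℝ) (hρ : 0 < ρ) (hD : 0 < D) (C : Finset ℤ) (hC : C.Nonempty) (A : ℤ → Set ℝ)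
    (I : Set ℝ) (hA : ∀ c ∈ C, A c ⊆ Set.Ico (c * ρ) ((c + 2) * ρ)) (hAI : ∀ c ∈ C, A c ⊆ I)
    (hdD : ∀ c ∈ C, ∀ i, (U i ∩ A c).Nonempty → d i ≤ D)
    (hmany : 8 * hitWeight U (fun i => d i ^ s) I * D ^ (1 - s) ≤ #C * ρ) :
    ∃ c ∈ C, hitWeight U (fun i => d i ^ s) (A c) ≤
      8 * hitWeight U (fun i => d i ^ s) I / #C := by
  set w : ℕ → ℝ := fun i => d i ^ s with hw
  set F := hitWeight U w I with hF
  have hF0 : 0 ≤ F := hitWeight_nonneg hU.weight_nonneg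
  have hC0 : (0 : ℝ) < #C := by exact_mod_cast hC.card_pos
  have hbad := hU.card_met_by_large_le hs1 ρ D hρ hD C A I hA hAI hdD
  set G := {c ∈ C | ¬ ∃ i, ρ ≤ d i ∧ (U i ∩ A c).Nonempty} with hG
  have hsplit : (#{c ∈ C | ∃ i, ρ ≤ d i ∧ (U i ∩ A c).Nonempty} : ℝ) + #G = #C := by
    exact_mod_cast card_filter_add_card_filter_not (s := C) _
  -- `hmany` says exactly that at most half of the cells are met by a large set.
  have hG2 : (#C : ℝ) / 2 ≤ #G := by
    have : 4 * F * D ^ (1 - s) / ρ ≤ #C / 2 := by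
      rw [div_le_iff₀ hρ]; linarith
    linarith
  have hGC : ∀ c ∈ G, c ∈ C := fun c hc => (mem_filter.1 hc).1
  have hGne : G.Nonempty := by
    rw [← card_pos]
    exact_mod_cast (half_pos hC0).trans_le hG2
  -- Only sets with `d i < ρ` meet the cells of `G`, and each meets at most `1 + 3` of them, so the
  -- weight of each is counted at most four times.
  have htot : ∑ c ∈ G, hitWeight U w (A c) ≤ 4 * F := by
    unfold hitWeight at hF ⊢
    rw [← Summable.tsum_finsetSum fun c _ => hU.summable.indicator _, hF, ← tsum_mul_left]
    refine Summable.tsum_le_tsum (fun i => ?_)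
      (summable_sum fun c _ => hU.summable.indicator _) ((hU.summable.indicator _).mul_left 4)
    have e : ∑ c ∈ G, {i | (U i ∩ A c).Nonempty}.indicator w i =
        (#{c ∈ G | (U i ∩ A c).Nonempty} : ℝ) * w i := by
      simp only [Set.indicator_apply, Set.mem_ofPred_eq]
      rw [← sum_filter, sum_const, nsmul_eq_mul]
    rw [e]
    rcases ({c ∈ G | (U i ∩ A c).Nonempty}).eq_empty_or_nonempty with he | ⟨c, hc⟩
    · rw [he]
      simpa using Set.indicator_nonneg (fun j _ => hU.weight_nonneg j) i
    · rw [mem_filter] at hc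
      have hsmall : d i < ρ := by
        by_contra! hlt
        exact (mem_filter.1 hc.1).2 ⟨i, hlt, hc.2⟩
      rw [Set.indicator_of_mem (show i ∈ {i | (U i ∩ I).Nonempty} from
        hc.2.mono (Set.inter_subset_inter_right _ (hAI c (hGC c hc.1))))]
      refine mul_le_mul_of_nonneg_right ?_ (hU.weight_nonneg i)
      have h1 := card_meet_le (U i) (d i) ρ (hU.pos _).le hρ (hU.dist_le _) G A
        fun c hc => hA c (hGC c hc)
      have h2 : d i / ρ ≤ 1 := by rw [div_le_one hρ]; exact hsmall.le
      linarith
  obtain ⟨c, hc, hle⟩ := exists_le_of_sum_le (f := fun c => hitWeight U w (A c))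
    (g := fun _ => 8 * F / #C) hGne (by
      rw [sum_const, nsmul_eq_mul]
      refine htot.trans ?_
      calc 4 * F = (#C : ℝ) / 2 * (8 * F / #C) := by field_simp; ring
        _ ≤ _ := by gcongr)
  exact ⟨c, hGC c hc, hle⟩

end WeightedCover

/-! ### Second moment of the distribution of reduced fractions -/

-- Cauchy–Schwarz applied to the fibre sizes of `f`: few collisions force a large image.
open Finset in
theorem sq_card_le_card_image_mul {α : Type*} [DecidableEq α] (X : Finset α) (f : α → ℤ) :
    #X ^ 2 ≤ #(X.image f) * #{p ∈ X ×ˢ X | f p.1 = f p.2} := by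
  have h1 : #{p ∈ X ×ˢ X | f p.1 = f p.2} = ∑ c ∈ X.image f, #{x ∈ X | f x = c} ^ 2 := by
    rw [card_eq_sum_card_fiberwise (f := fun p => f p.1) (t := X.image f)]
    · refine sum_congr rfl fun c _ => ?_
      rw [sq, ← card_product]
      congr 1
      ext ⟨x, y⟩
      simp only [mem_filter, mem_product]
      constructor
      · rintro ⟨⟨⟨hx, hy⟩, h⟩, h'⟩
        exact ⟨⟨hx, h'⟩, hy, h ▸ h'⟩
      · rintro ⟨⟨hx, h⟩, hy, h'⟩
        exact ⟨⟨⟨hx, hy⟩, h.trans h'.symm⟩, h⟩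
    · intro p hp
      simp only [coe_filter, mem_product, Set.mem_ofPred_eq] at hp
      exact mem_coe.2 (mem_image_of_mem _ hp.1.1)
  rw [h1, card_eq_sum_card_image f X]
  exact sq_sum_le_card_mul_sum_sq

open Finset in
/-- The reduced fractions `a / q` in `(0, 1]` with denominator `q ∈ Q`, as pairs `⟨q, a⟩`. -/
def reducedFractions (Q : Finset ℕ) : Finset (Σ _ : ℕ, ℕ) :=
  Q.sigma fun q => {a ∈ Icc 1 q | Nat.Coprime a q}

theorem mem_reducedFractions {Q : Finset ℕ} {x : Σ _ : ℕ, ℕ} :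
    x ∈ reducedFractions Q ↔ x.1 ∈ Q ∧ (1 ≤ x.2 ∧ x.2 ≤ x.1) ∧ Nat.Coprime x.2 x.1 := by
  simp [reducedFractions]

theorem eq_of_coprime_of_mul_eq {a q b r : ℕ} (ha : Nat.Coprime a q) (hb : Nat.Coprime b r)
    (h : a * r = b * q) : a = b ∧ q = r := by
  have h1 : a ∣ b := ha.dvd_of_dvd_mul_right ⟨r, h.symm⟩
  have h2 : b ∣ a := hb.dvd_of_dvd_mul_right ⟨q, h⟩
  have h3 : q ∣ r := ha.symm.dvd_of_dvd_mul_left ⟨b, by rw [h]; ring⟩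
  have h4 : r ∣ q := hb.symm.dvd_of_dvd_mul_left ⟨a, by rw [← h]; ring⟩
  exact ⟨Nat.dvd_antisymm h1 h2, Nat.dvd_antisymm h3 h4⟩

-- Multiplying by `q * r ≤ 4 * N ^ 2` turns closeness into a bound on `|a * r - b * q|`. Coincident
-- pairs, where this integer vanishes, occur only for `q = r`, by reducedness.
open Finset in
theorem card_close_fractions_le (q r N H : ℕ) (hN : 1 ≤ N) (ρ : ℝ) (hq : q ∈ Ico N (2 * N))
    (hr : r ∈ Ico N (2 * N)) (hH : ∀ k : ℕ, (k : ℝ) ≤ 4 * N ^ 2 * ρ → k ≤ H) (hρ : 0 ≤ ρ) :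
    #{x ∈ Icc 1 q ×ˢ Icc 1 r | (Nat.Coprime x.1 q ∧ Nat.Coprime x.2 r) ∧
      |(x.1 : ℝ) / q - x.2 / r| < ρ} ≤ 2 * H + if q = r then q else 0 := by
  rw [mem_Ico] at hq hr
  have hq0 : 0 < q := by omega
  have hr0 : 0 < r := by omega
  have hq0' : (0 : ℝ) < q := by exact_mod_cast hq0
  have hr0' : (0 : ℝ) < r := by exact_mod_cast hr0
  set S := {x ∈ Icc 1 q ×ˢ Icc 1 r | (Nat.Coprime x.1 q ∧ Nat.Coprime x.2 r) ∧
      |(x.1 : ℝ) / q - x.2 / r| < ρ} with hS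
  rw [← card_filter_add_card_filter_not (s := S) (fun x => (x.1 * r - x.2 * q : ℤ) ≠ 0)]
  refine add_le_add ?_ ?_
  · refine le_trans (card_le_card ?_) (card_close_pairs_le q r H hq0)
    rintro ⟨a, b⟩ hx
    simp only [hS, mem_filter] at hx ⊢
    obtain ⟨⟨h1, -, h2⟩, h3⟩ := hx
    refine ⟨h1, h3, ?_⟩
    have e : (((a * r - b * q : ℤ).natAbs : ℕ) : ℝ) = |(a : ℝ) / q - b / r| * (q * r) := by
      rw [Nat.cast_natAbs]
      push_cast
      rw [← abs_of_pos (mul_pos hq0' hr0'), ← abs_mul]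
      congr 1
      field_simp
    have h4 : (((a * r - b * q : ℤ).natAbs : ℕ) : ℝ) ≤ 4 * N ^ 2 * ρ := by
      have hq2 : (q : ℝ) ≤ 2 * N := by exact_mod_cast hq.2.le
      have hr2 : (r : ℝ) ≤ 2 * N := by exact_mod_cast hr.2.le
      rw [e]
      calc _ ≤ ρ * (2 * N * (2 * N)) := by gcongr
        _ = _ := by ring
    have h5 := hH _ h4
    rw [Int.abs_eq_natAbs]
    exact_mod_cast h5
  · split_ifs with hqr
    · subst hqr
      calc _ ≤ #(Icc 1 q) := by
            refine card_le_card_of_injOn (fun x => x.1) ?_ ?_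
            · rintro ⟨a, b⟩ hx
              simp only [hS, coe_filter, mem_filter, mem_product, Set.mem_ofPred_eq] at hx
              exact mem_coe.2 hx.1.1.1
            · rintro ⟨a, b⟩ hx ⟨c, d⟩ hy h
              simp only [hS, coe_filter, mem_filter, Set.mem_ofPred_eq, not_not] at hx hy h
              have e1 : a = b := by
                have : (a * q : ℤ) = b * q := by linarith [hx.2]
                exact Nat.eq_of_mul_eq_mul_right hq0 (by exact_mod_cast this)
              have e2 : c = d := by
                have : (c * q : ℤ) = d * q := by linarith [hy.2]
                exact Nat.eq_of_mul_eq_mul_right hq0 (by exact_mod_cast this)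
              subst e1 e2 h
              rfl
        _ = q := by simp
    · rw [Nat.le_zero, card_eq_zero, eq_empty_iff_forall_notMem]
      rintro ⟨a, b⟩ hx
      simp only [hS, mem_filter, not_not] at hx
      obtain ⟨⟨-, ⟨h1, h2⟩, -⟩, h3⟩ := hx
      have h4 : (a * r : ℤ) = b * q := by linarith
      exact hqr (eq_of_coprime_of_mul_eq h1 h2 (by exact_mod_cast h4)).2

open Finset in
/-- The second moment estimate: few pairs of reduced fractions lie in a common cell. -/
theorem card_pairs_same_cell_le (N : ℕ) (hN : 1 ≤ N) (Q : Finset ℕ) (hQ : Q ⊆ Ico N (2 * N))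
    (hne : Q.Nonempty) (X : Finset (Σ _ : ℕ, ℕ)) (hX : X ⊆ reducedFractions Q) (ρ : ℝ)
    (hρ : ρ = 1 / (#Q * N)) :
    (#{p ∈ X ×ˢ X | ⌊(p.1.2 : ℝ) / p.1.1 / ρ⌋ = ⌊(p.2.2 : ℝ) / p.2.1 / ρ⌋} : ℝ)
      ≤ 10 * N * #Q := by
  have hQ0 : (0 : ℝ) < #Q := by exact_mod_cast hne.card_pos
  have hN0 : (0 : ℝ) < N := by exact_mod_cast hN
  have hρ0 : 0 < ρ := by rw [hρ]; positivity
  set H := ⌊4 * N / (#Q : ℝ)⌋₊ with hH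
  have hH1 : (H : ℝ) ≤ 4 * N / #Q := Nat.floor_le (by positivity)
  have hH2 : ∀ k : ℕ, (k : ℝ) ≤ 4 * N ^ 2 * ρ → k ≤ H := by
    intro k hk
    refine Nat.le_floor (hk.trans_eq ?_)
    rw [hρ]; field_simp
  have hfib : #{p ∈ X ×ˢ X | ⌊(p.1.2 : ℝ) / p.1.1 / ρ⌋ = ⌊(p.2.2 : ℝ) / p.2.1 / ρ⌋} ≤
      ∑ z ∈ Q ×ˢ Q, (2 * H + if z.1 = z.2 then z.1 else 0) := by
    rw [card_eq_sum_card_fiberwise (f := fun p => (p.1.1, p.2.1)) (t := Q ×ˢ Q)]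
    · refine sum_le_sum fun z hz => ?_
      obtain ⟨q, r⟩ := z
      rw [mem_product] at hz
      refine le_trans ?_ (card_close_fractions_le q r N H hN ρ (hQ hz.1) (hQ hz.2) hH2 hρ0.le)
      refine card_le_card_of_injOn (fun p => (p.1.2, p.2.2)) ?_ ?_
      · rintro ⟨⟨q', a⟩, ⟨r', b⟩⟩ hp
        simp only [coe_filter, mem_filter, mem_product, Set.mem_ofPred_eq, Prod.mk.injEq] at hp
        obtain ⟨⟨⟨h1, h2⟩, h3⟩, rfl, rfl⟩ := hp
        have h1 := mem_reducedFractions.1 (hX h1)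
        have h2 := mem_reducedFractions.1 (hX h2)
        simp only [coe_filter, mem_product, mem_Icc, Set.mem_ofPred_eq]
        refine ⟨⟨h1.2.1, h2.2.1⟩, ⟨h1.2.2, h2.2.2⟩, ?_⟩
        have h4 := Int.abs_sub_lt_one_of_floor_eq_floor h3
        rwa [← sub_div, abs_div, abs_of_pos hρ0, div_lt_one hρ0] at h4
      · rintro ⟨⟨q', a⟩, ⟨r', b⟩⟩ hp ⟨⟨q'', a'⟩, ⟨r'', b'⟩⟩ hp' h
        simp only [coe_filter, mem_filter, mem_product, Set.mem_ofPred_eq, Prod.mk.injEq]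
          at hp hp' h
        obtain ⟨-, rfl, rfl⟩ := hp
        obtain ⟨-, rfl, rfl⟩ := hp'
        obtain ⟨rfl, rfl⟩ := h
        rfl
    · intro p hp
      simp only [coe_filter, mem_product, Set.mem_ofPred_eq] at hp
      exact mem_coe.2 (mem_product.2 ⟨(mem_reducedFractions.1 (hX hp.1.1)).1,
        (mem_reducedFractions.1 (hX hp.1.2)).1⟩)
  have hsum : ∑ z ∈ Q ×ˢ Q, (2 * H + if z.1 = z.2 then z.1 else 0) =
      #Q * #Q * (2 * H) + ∑ q ∈ Q, q := by
    rw [sum_add_distrib, sum_const, card_product, smul_eq_mul, sum_product]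
    congr 1
    refine sum_congr rfl fun q hq => ?_
    simp [hq]
  have hsum2 : ∑ q ∈ Q, q ≤ #Q * (2 * N) := by
    rw [← smul_eq_mul]
    exact sum_le_card_nsmul Q _ _ fun q hq => (mem_Ico.1 (hQ hq)).2.le
  have h1 : (#{p ∈ X ×ˢ X | ⌊(p.1.2 : ℝ) / p.1.1 / ρ⌋ = ⌊(p.2.2 : ℝ) / p.2.1 / ρ⌋} : ℝ) ≤
      #Q * #Q * (2 * H) + #Q * (2 * N) := by
    exact_mod_cast hfib.trans (hsum.le.trans (Nat.add_le_add_left hsum2 _))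
  -- Since `H ≤ 4 * N / #Q`, distinct fractions contribute `8 * N * #Q` and coincident ones `2 * N *
  -- #Q`.
  calc _ ≤ (#Q : ℝ) * #Q * (2 * H) + #Q * (2 * N) := h1
    _ ≤ (#Q : ℝ) * #Q * (2 * (4 * N / #Q)) + #Q * (2 * N) := by gcongr
    _ = _ := by field_simp; ring

/-! ### Fractions in prescribed cells -/

open Finset Classical in
/-- The reduced fractions in the left halves of the cells `j ∈ G` of side `mesh`. -/
noncomputable def fractionsIn (Q : Finset ℕ) (G : Finset ℤ) (mesh : ℝ) : Finset (Σ _ : ℕ, ℕ) :=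
  {x ∈ reducedFractions Q | ∃ j ∈ G, j * mesh < (x.2 : ℝ) / x.1 ∧
    (x.2 : ℝ) / x.1 ≤ (j + 1 / 2) * mesh}

open Finset Classical in
theorem le_card_fractionsIn (N : ℕ) (hN : 1 ≤ N) (Q : Finset ℕ) (hQ : Q ⊆ Ico N (2 * N))
    (G : Finset ℤ) (mesh M : ℝ) (hmesh : 0 < mesh) (hG : ∀ j ∈ G, 0 ≤ j ∧ (j + 1) * mesh ≤ 1)
    (hω : ∀ q ∈ Q, (2 : ℝ) ^ #q.primeFactors ≤ M) :
    #Q * (#G * (N * mesh / 2 / M - M)) ≤ (#(fractionsIn Q G mesh) : ℝ) := by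
  have hN0 : (0 : ℝ) < N := by exact_mod_cast hN
  have hcard : (#(fractionsIn Q G mesh) : ℝ) = ∑ q ∈ Q, (#{a ∈ Icc 1 q | Nat.Coprime a q ∧
      ∃ j ∈ G, j * mesh < (a : ℝ) / q ∧ (a : ℝ) / q ≤ (j + 1 / 2) * mesh} : ℝ) := by
    rw [← Nat.cast_sum, ← card_sigma]
    congr 2
    ext x
    simp [fractionsIn, mem_reducedFractions, and_assoc]
  rw [hcard, ← nsmul_eq_mul]
  refine card_nsmul_le_sum Q _ _ fun q hq => ?_
  have hqN := mem_Ico.1 (hQ hq)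
  have hq1 : 0 < q := by omega
  have hq0 : (0 : ℝ) < q := by exact_mod_cast hq1
  have hNq : (N : ℝ) ≤ q := by exact_mod_cast hqN.1
  have hj : ∀ j ∈ G, (0 : ℝ) ≤ j := fun j hj => by exact_mod_cast (hG j hj).1
  have hmem : ∀ j ∈ G, ∀ a : ℕ, a ∈ Ioc ⌊q * (j * mesh)⌋₊ ⌊q * ((j + 1 / 2) * mesh)⌋₊ ↔
      j * mesh < (a : ℝ) / q ∧ (a : ℝ) / q ≤ (j + 1 / 2) * mesh := by
    intro j hjG a
    have := hj j hjG
    rw [mem_Ioc, Nat.floor_lt (by positivity), Nat.le_floor_iff (by positivity),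
      lt_div_iff₀ hq0, div_le_iff₀ hq0, mul_comm (q : ℝ), mul_comm (q : ℝ)]
  have hsub : G.biUnion (fun j => {a ∈ Ioc ⌊q * (j * mesh)⌋₊ ⌊q * ((j + 1 / 2) * mesh)⌋₊ |
      Nat.Coprime a q}) ⊆ {a ∈ Icc 1 q | Nat.Coprime a q ∧
      ∃ j ∈ G, j * mesh < (a : ℝ) / q ∧ (a : ℝ) / q ≤ (j + 1 / 2) * mesh} := by
    intro a ha
    simp only [mem_biUnion, mem_filter] at ha
    obtain ⟨j, hjG, ha, hc⟩ := ha
    rw [hmem j hjG] at ha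
    have := hj j hjG
    have h0 : 0 < (a : ℝ) / q := lt_of_le_of_lt (by positivity) ha.1
    have h1 : (a : ℝ) / q ≤ 1 := by
      have := (hG j hjG).2
      nlinarith [ha.2]
    simp only [mem_filter, mem_Icc]
    refine ⟨⟨?_, ?_⟩, hc, j, hjG, ha⟩
    · rcases Nat.eq_zero_or_pos a with h | h
      · simp [h] at h0
      · exact h
    · rw [div_le_one hq0] at h1
      exact_mod_cast h1
  have hdisj : (G : Set ℤ).PairwiseDisjoint (fun j =>
      {a ∈ Ioc ⌊q * (j * mesh)⌋₊ ⌊q * ((j + 1 / 2) * mesh)⌋₊ | Nat.Coprime a q}) := by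
    intro j hj' i hi hne
    refine disjoint_left.2 fun a ha hb => hne ?_
    rw [mem_filter, hmem _ (mem_coe.1 hj')] at ha
    rw [mem_filter, hmem _ (mem_coe.1 hi)] at hb
    have h1 := lt_of_mul_lt_mul_right (ha.1.1.trans_le hb.1.2) hmesh.le
    have h2 := lt_of_mul_lt_mul_right (hb.1.1.trans_le ha.1.2) hmesh.le
    have h3 : (j : ℝ) < (i + 1 : ℤ) := by push_cast; linarith
    have h4 : (i : ℝ) < (j + 1 : ℤ) := by push_cast; linarith
    have h3 := Int.cast_lt.1 h3
    have h4 := Int.cast_lt.1 h4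
    omega
  refine le_trans ?_ (Nat.cast_le.2 (card_le_card hsub))
  rw [card_biUnion hdisj, Nat.cast_sum, ← nsmul_eq_mul]
  refine card_nsmul_le_sum G _ _ fun j hjG => ?_
  have := hj j hjG
  refine le_trans ?_ (le_card_coprime q hq1.ne' _ _ (by positivity) (by gcongr; linarith))
  have hω := hω q hq
  have e : (q : ℝ) * ((j + 1 / 2) * mesh) - q * (j * mesh) = q * mesh / 2 := by ring
  rw [e]
  gcongr

/-! ### Choice of scales and the descent step -/

theorem eventually_scale_bounds {δ : ℝ} (hδ : 0 < δ) (C L : ℝ) (hL : 0 < L) :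
    ∀ᶠ N : ℕ in Filter.atTop,
      10 ≤ (N : ℝ) ^ δ ∧ 16 ≤ (N : ℝ) ^ δ * L ∧ C * 2 ^ δ ≤ (N : ℝ) ^ δ := by
  have h : Filter.Tendsto (fun N : ℕ => (N : ℝ) ^ δ) Filter.atTop Filter.atTop :=
    (tendsto_rpow_atTop hδ).comp tendsto_natCast_atTop_atTop
  filter_upwards [h.eventually_ge_atTop 10, h.eventually_ge_atTop (16 / L),
    h.eventually_ge_atTop (C * 2 ^ δ)] with N h1 h2 h3
  exact ⟨h1, by rwa [div_le_iff₀ hL] at h2, h3⟩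

open Finset in
theorem exists_cells_subset (u L mesh : ℝ) (hu : 0 ≤ u) (hmesh : 0 < mesh)
    (hL : 4 * mesh ≤ L) :
    ∃ G : Finset ℤ, L / (2 * mesh) ≤ #G ∧ ∀ j ∈ G, 0 ≤ j ∧ u ≤ j * mesh ∧
      (j + 1) * mesh ≤ u + L := by
  refine ⟨Icc ⌈u / mesh⌉ (⌊(u + L) / mesh⌋ - 1), ?_, ?_⟩
  · rw [Int.card_Icc]
    have h1 := Int.ceil_lt_add_one (u / mesh)
    have h2 := Int.lt_floor_add_one ((u + L) / mesh)
    have h3 : (4 : ℝ) ≤ L / mesh := by rwa [le_div_iff₀ hmesh]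
    have h4 : L / (2 * mesh) = L / mesh / 2 := by rw [mul_comm, div_div]
    have h5 : (u + L) / mesh = u / mesh + L / mesh := add_div _ _ _
    have h6 : ((⌊(u + L) / mesh⌋ - 1 + 1 - ⌈u / mesh⌉ : ℤ) : ℝ) ≤
        ((⌊(u + L) / mesh⌋ - 1 + 1 - ⌈u / mesh⌉).toNat : ℝ) := by
      exact_mod_cast Int.self_le_toNat _
    push_cast at h6
    linarith
  · intro j hj
    rw [mem_Icc] at hj
    have h1 : u / mesh ≤ j := Int.ceil_le.1 hj.1
    have h2 : ((j + 1 : ℤ) : ℝ) ≤ (u + L) / mesh := Int.le_floor.1 (by linarith [hj.2])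
    push_cast at h2
    rw [div_le_iff₀ hmesh] at h1
    rw [le_div_iff₀ hmesh] at h2
    have h3 : 0 ≤ ⌈u / mesh⌉ := Int.ceil_nonneg (by positivity)
    exact ⟨h3.trans hj.1, h1, h2⟩

open Finset Classical in
/-- Many cells of side `mesh` inside an interval are met by small sets of the cover only. -/
theorem WeightedCover.exists_cells_unmet_by_large {s : ℝ} {U : ℕ → Set ℝ} {d : ℕ → ℝ}
    (hU : WeightedCover s U d) (hs0 : 0 < s) (hs1 : s < 1)
    (u L mesh : ℝ) (hu : 0 ≤ u) (hL : 0 < L) (hmesh : 0 < mesh) (hLmesh : 4 * mesh ≤ L)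
    (hF : hitWeight U (fun i => d i ^ s) (Set.Icc u (u + L)) ≤ L ^ s / 16) :
    ∃ G : Finset ℤ, L / mesh / 4 ≤ #G ∧ ∀ j ∈ G, 0 ≤ j ∧ u ≤ j * mesh ∧
      (j + 1) * mesh ≤ u + L ∧
      ∀ i, (U i ∩ Set.Ico (j * mesh) ((j + 1) * mesh)).Nonempty → d i < mesh := by
  obtain ⟨G₀, hG₀, hG₀I⟩ := exists_cells_subset u L mesh hu hmesh hLmesh
  set A₀ : ℤ → Set ℝ := fun j => Set.Ico (j * mesh) ((j + 1) * mesh) with hA₀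
  have hA₀I : ∀ j ∈ G₀, A₀ j ⊆ Set.Icc u (u + L) := fun j hj x hx =>
    ⟨(hG₀I j hj).2.1.trans hx.1, hx.2.le.trans (hG₀I j hj).2.2⟩
  -- The weight hypothesis forces `d i ≤ L` for every set met, so `D = L` is admissible. The factor
  -- `16` then makes the bad cells at most `L / mesh / 4`, half of the lower bound for `#G₀`.
  have hbad := hU.card_met_by_large_le hs1 mesh L hmesh hL G₀ A₀ (Set.Icc u (u + L))
    (fun j _ => Set.Ico_subset_Ico_right (by gcongr; norm_num)) hA₀I
    (fun j hj i hi => hU.le_of_hitWeight_le hs0 hL.le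
      (hF.trans (by have : 0 ≤ L ^ s := by positivity
                    linarith))
      (hi.mono (Set.inter_subset_inter_right _ (hA₀I j hj))))
  set G := {j ∈ G₀ | ¬ ∃ i, mesh ≤ d i ∧ (U i ∩ A₀ j).Nonempty} with hG
  have hsplit : (#{j ∈ G₀ | ∃ i, mesh ≤ d i ∧ (U i ∩ A₀ j).Nonempty} : ℝ) + #G = #G₀ := by
    exact_mod_cast card_filter_add_card_filter_not (s := G₀) _
  refine ⟨G, ?_, fun j hj => ?_⟩
  · have h1 : 4 * hitWeight U (fun i => d i ^ s) (Set.Icc u (u + L)) * L ^ (1 - s) / mesh ≤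
        L / mesh / 4 := by
      have h2 : L ^ s * L ^ (1 - s) = L := by rw [← Real.rpow_add hL]; simp
      calc _ ≤ 4 * (L ^ s / 16) * L ^ (1 - s) / mesh := by gcongr
        _ = (L ^ s * L ^ (1 - s)) / mesh / 4 := by ring
        _ = _ := by rw [h2]
    have h3 : L / (2 * mesh) = L / mesh / 2 := by rw [mul_comm, div_div]
    linarith
  · have hj := mem_filter.1 hj
    refine ⟨(hG₀I j hj.1).1, (hG₀I j hj.1).2.1, (hG₀I j hj.1).2.2, fun i hi => ?_⟩
    by_contra! hlt
    exact hj.2 ⟨i, hlt, hi⟩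

/-- Here `K` is the number of occupied cells: Cauchy–Schwarz gives a proportion `t ^ (-6) / 10`, and
one more factor `t ≥ 10` absorbs the constant. -/
theorem one_div_pow_le_of_sq_le {q N t K : ℝ} (hq : 0 < q) (hN : 0 < N) (ht : 10 ≤ t)
    (hK : 0 ≤ K) (h : (q * N / t ^ 3) ^ 2 ≤ K * (10 * N * q)) :
    1 / t ^ 7 ≤ K * (1 / (q * N)) := by
  have ht0 : 0 < t := by linarith
  have h2 : 1 / t ^ 6 ≤ K * (1 / (q * N)) * 10 := by
    calc 1 / t ^ 6 = (q * N / t ^ 3) ^ 2 / (q * N) ^ 2 := by field_simp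
      _ ≤ K * (10 * N * q) / (q * N) ^ 2 := by gcongr
      _ = _ := by field_simp
  have h3 : 1 / t ^ 7 = 1 / t ^ 6 / t := by field_simp
  rw [h3, div_le_iff₀ ht0]
  have : 0 ≤ K * (1 / (q * N)) := by positivity
  nlinarith

/-- With `r = √N` and mesh `1 / r`, the sieve error `t ^ 2` is at most half the main term `r / (2 *
t ^ 2)` because `t ^ 8 ≤ r`; the fixed length `L` is absorbed by `16 ≤ t * L`. -/
theorem mul_div_pow_le_count {q r t L g : ℝ} (hq : 0 ≤ q) (ht : 10 ≤ t) (htL : 16 ≤ t * L)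
    (hr : t ^ 8 ≤ r) (hg : L * r / 4 ≤ g) :
    q * (r * r) / t ^ 3 ≤ q * (g * (r * r * (1 / r) / 2 / t ^ 2 - t ^ 2)) := by
  have ht0 : 0 < t := by linarith
  have hr0 : 0 < r := (pow_pos ht0 8).trans_le hr
  have hL : 0 < L := by
    by_contra! h
    nlinarith
  have h2 : r / t ^ 2 / 4 ≤ r * r * (1 / r) / 2 / t ^ 2 - t ^ 2 := by
    have e : r * r * (1 / r) / 2 / t ^ 2 - t ^ 2 = r / t ^ 2 / 4 + (r / t ^ 2 / 4 - t ^ 2) := by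
      field_simp; ring
    have h3 : t ^ 2 ≤ r / t ^ 2 / 4 := by
      rw [div_div, le_div_iff₀ (by positivity)]
      have h4 : 4 * t ^ 4 ≤ t ^ 8 := by
        have : (4 : ℝ) ≤ t ^ 4 := by
          have := le_self_pow₀ (show 1 ≤ t by linarith) (show 4 ≠ 0 by norm_num)
          linarith
        nlinarith [pow_pos ht0 4]
      linarith
    linarith
  have hg0 : 0 ≤ g := le_trans (by positivity) hg
  calc q * (r * r) / t ^ 3 = q * (r * r) * 16 / (16 * t ^ 3) := by field_simp
    _ ≤ q * (r * r) * (t * L) / (16 * t ^ 3) := by gcongr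
    _ = q * (L * r / 4 * (r / t ^ 2 / 4)) := by field_simp; ring
    _ ≤ _ := by gcongr

theorem pow_mul_le_rpow_div {s t ρ : ℝ} (hs1 : s < 1) (ht : 10 ≤ t)
    (hρ : 0 < ρ) (h : ρ ^ (1 - s) ≤ (t ^ 16)⁻¹) :
    t ^ 7 * ρ / 2 ≤ (ρ / (2 * t)) ^ s / 16 := by
  have ht0 : 0 < t := by linarith
  have hρs : t ^ 16 * ρ ≤ ρ ^ s := by
    have h1 : ρ ^ (1 - s) * ρ ^ s = ρ := by rw [← Real.rpow_add hρ]; simp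
    have h3 : 0 < ρ ^ s := by positivity
    have h4 : ρ ≤ (t ^ 16)⁻¹ * ρ ^ s := by
      nth_rewrite 1 [← h1]
      exact mul_le_mul_of_nonneg_right h h3.le
    rwa [inv_mul_eq_div, le_div_iff₀ (by positivity), mul_comm] at h4
  have hℓs : ρ ^ s / (2 * t) ≤ (ρ / (2 * t)) ^ s := by
    rw [Real.div_rpow hρ.le (by positivity)]
    gcongr
    calc (2 * t) ^ s ≤ (2 * t) ^ (1 : ℝ) :=
          Real.rpow_le_rpow_of_exponent_le (by linarith) hs1.le
      _ = 2 * t := Real.rpow_one _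
  have h1 : (16 : ℝ) ≤ t ^ 8 := by
    calc (16 : ℝ) ≤ 10 ^ 8 := by norm_num
      _ ≤ t ^ 8 := by gcongr
  calc t ^ 7 * ρ / 2 = 16 * (t ^ 7 * ρ) / 32 := by ring
    _ ≤ t ^ 8 * (t ^ 7 * ρ) / 32 := by gcongr
    _ = t ^ 16 * ρ / (2 * t) / 16 := by field_simp; norm_num
    _ ≤ ρ ^ s / (2 * t) / 16 := by gcongr
    _ ≤ _ := by gcongr

set_option maxHeartbeats 800000 in
open Finset Classical in
theorem exists_child_of_large_values {s : ℝ} {U : ℕ → Set ℝ} {d : ℕ → ℝ}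
    (hU : WeightedCover s U d) (hs0 : 0 < s) (hs1 : s < 1)
    (u L : ℝ) (hu : 0 ≤ u) (hL : 0 < L) (huL : u + L ≤ 1)
    (hF : hitWeight U (fun i => d i ^ s) (Set.Icc u (u + L)) ≤ L ^ s / 16)
    (N : ℕ) (hN : 1 ≤ N) (t : ℝ) (ht : t = (N : ℝ) ^ ((1 - s) / 16)) (ht10 : 10 ≤ t)
    (htL : 16 ≤ t * L) (Q : Finset ℕ) (hQ : Q ⊆ Ico N (2 * N)) (hne : Q.Nonempty)
    (hω : ∀ q ∈ Q, (2 : ℝ) ^ #q.primeFactors ≤ t ^ 2) :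
    ∃ q ∈ Q, ∃ a : ℕ, 1 ≤ a ∧ a ≤ q ∧ Nat.Coprime a q ∧ u ≤ (a : ℝ) / q ∧
      (a : ℝ) / q + 1 / (#Q * N) / (2 * t) ≤ u + L ∧
      hitWeight U (fun i => d i ^ s)
        (Set.Icc ((a : ℝ) / q) ((a : ℝ) / q + 1 / (#Q * N) / (2 * t))) ≤
        (1 / (#Q * N) / (2 * t)) ^ s / 16 := by
  have hN0 : (0 : ℝ) < N := by exact_mod_cast hN
  have hN1 : (1 : ℝ) ≤ N := by exact_mod_cast hN
  have hQ0 : (0 : ℝ) < #Q := by exact_mod_cast hne.card_pos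
  have hQ1 : (1 : ℝ) ≤ #Q := by exact_mod_cast hne.card_pos
  have ht0 : 0 < t := by linarith
  have hNt : t ^ 16 ≤ N := by
    rw [ht, ← Real.rpow_natCast, ← Real.rpow_mul hN0.le]
    refine (Real.rpow_le_rpow_of_exponent_le hN1 (?_ : _ ≤ (1 : ℝ))).trans_eq (Real.rpow_one _)
    push_cast; linarith
  have hNt' : (N : ℝ) ^ (-(1 - s)) = (t ^ 16)⁻¹ := by
    rw [Real.rpow_neg hN0.le, ht, ← Real.rpow_natCast, ← Real.rpow_mul hN0.le]
    congr 2; push_cast; ring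
  have hL1 : L ≤ 1 := by linarith
  set w : ℕ → ℝ := fun i => d i ^ s with hw
  set F := hitWeight U w (Set.Icc u (u + L)) with hFdef
  have hF0 : 0 ≤ F := hitWeight_nonneg hU.weight_nonneg
  set ρ : ℝ := 1 / (#Q * N) with hρ
  have hρ0 : 0 < ρ := by positivity
  have hρN : ρ ≤ 1 / N := by
    rw [hρ]
    refine one_div_le_one_div_of_le hN0 ?_
    nlinarith
  -- Mesh `N ^ (-1/2)` is coarse enough for the sieve to count fractions in each cell, yet `mesh ^
  -- (1 - s) = t ^ (-8)` beats the lower bound `t ^ (-7)` for the proportion of occupied cells.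
  set r : ℝ := √N with hr
  have hr0 : 0 < r := Real.sqrt_pos.2 hN0
  have hrr : r * r = N := Real.mul_self_sqrt hN0.le
  have hrt : t ^ 8 ≤ r := by
    refine Real.le_sqrt_of_sq_le ?_
    rw [← pow_mul]; exact hNt
  have ht8 : t ≤ t ^ 8 := le_self_pow₀ (by linarith) (by norm_num)
  set mesh : ℝ := 1 / r with hmesh
  have hmesh0 : 0 < mesh := by positivity
  have hρmesh : ρ ≤ mesh := by
    refine hρN.trans ?_
    rw [hmesh, ← hrr]
    refine one_div_le_one_div_of_le hr0 ?_
    nlinarith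
  have hLmesh : 4 * mesh ≤ L := by
    rw [hmesh, mul_one_div, div_le_iff₀ hr0]
    nlinarith
  have hmeshpow : mesh ^ (1 - s) = (t ^ 8)⁻¹ := by
    have h1 : (mesh ^ (1 - s)) ^ 2 = ((t ^ 8)⁻¹) ^ 2 := by
      rw [← Real.rpow_natCast, ← Real.rpow_mul hmesh0.le, mul_comm, Real.rpow_mul hmesh0.le,
        Real.rpow_natCast, hmesh, div_pow, one_pow, sq r, hrr, one_div, Real.inv_rpow hN0.le,
        ← Real.rpow_neg hN0.le, hNt', inv_pow, ← pow_mul]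
    exact (sq_eq_sq₀ (by positivity) (by positivity)).1 h1
  -- cells of side `mesh` that no large set of the cover meets
  obtain ⟨G, hGcard, hG⟩ :=
    hU.exists_cells_unmet_by_large hs0 hs1 u L mesh hu hL hmesh0 hLmesh hF
  have hGcard : L * r / 4 ≤ #G := by rwa [hmesh, div_div_eq_mul_div, div_one] at hGcard
  -- the fractions in these cells and the cells of side `ρ` that they occupy
  set X := fractionsIn Q G mesh with hX
  have hXmem : ∀ x ∈ X, x ∈ reducedFractions Q ∧ ∃ j ∈ G, j * mesh < (x.2 : ℝ) / x.1 ∧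
      (x.2 : ℝ) / x.1 ≤ (j + 1 / 2) * mesh := fun x hx => mem_filter.1 hx
  have hP : (#Q : ℝ) * N / t ^ 3 ≤ #X := by
    have h1 := le_card_fractionsIn N hN Q hQ G mesh (t ^ 2) hmesh0
      (fun j hj => ⟨(hG j hj).1, (hG j hj).2.2.1.trans huL⟩) hω
    refine le_trans ?_ h1
    rw [hmesh, ← hrr]
    exact mul_div_pow_le_count hQ0.le ht10 htL hrt hGcard
  set cell : (Σ _ : ℕ, ℕ) → ℤ := fun x => ⌊(x.2 : ℝ) / x.1 / ρ⌋ with hcell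
  set C := X.image cell with hC
  have hE := card_pairs_same_cell_le N hN Q hQ hne X (filter_subset _ _) ρ hρ
  have hCS : (#X : ℝ) ^ 2 ≤ #C * (10 * N * #Q) := by
    have h1 : (#X : ℝ) ^ 2 ≤ #C * (#{p ∈ X ×ˢ X | cell p.1 = cell p.2} : ℝ) := by
      exact_mod_cast sq_card_le_card_image_mul X cell
    exact h1.trans (by gcongr)
  have hK : 1 / t ^ 7 ≤ #C * ρ :=
    one_div_pow_le_of_sq_le hQ0 hN0 ht10 (Nat.cast_nonneg _)
      ((pow_le_pow_left₀ (by positivity) hP 2).trans hCS)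
  have hC0 : (0 : ℝ) < #C := by
    by_contra! h
    have h1 : 0 < 1 / t ^ 7 := by positivity
    nlinarith
  have hCne : C.Nonempty := card_pos.1 (by exact_mod_cast hC0)
  have hch : ∀ c : ℤ, ∃ x : Σ _ : ℕ, ℕ, c ∈ C → x ∈ X ∧ cell x = c := by
    intro c
    by_cases hc : c ∈ C
    · obtain ⟨x, hx⟩ := mem_image.1 hc
      exact ⟨x, fun _ => hx⟩
    · exact ⟨⟨0, 0⟩, fun h => absurd h hc⟩
  choose x hx using hch
  -- The factor `2` makes `ℓ` strictly less than the guaranteed `ψ q / q`. As `ℓ < ρ / 2 ≤ mesh /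
  -- 2`, an interval starting in the left half of a mesh cell stays inside that cell.
  set ℓ := ρ / (2 * t) with hℓ
  have hℓ0 : 0 < ℓ := by positivity
  have hℓρ : ℓ < ρ / 2 := by
    rw [hℓ, div_lt_div_iff₀ (by positivity) (by norm_num)]
    nlinarith
  set A : ℤ → Set ℝ := fun c =>
    Set.Icc (((x c).2 : ℝ) / (x c).1) (((x c).2 : ℝ) / (x c).1 + ℓ) with hA
  -- The interval starts in cell `c` but may spill into the next one, hence `c + 2`.
  have hAcell : ∀ c ∈ C, A c ⊆ Set.Ico (c * ρ) ((c + 2) * ρ) := by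
    intro c hc y hy
    have h1 := (hx c hc).2
    rw [hcell, Int.floor_eq_iff, le_div_iff₀ hρ0, div_lt_iff₀ hρ0] at h1
    exact ⟨h1.1.trans hy.1, hy.2.trans_lt (by linarith)⟩
  have hAG : ∀ c ∈ C, ∃ j ∈ G, A c ⊆ Set.Ico (j * mesh) ((j + 1) * mesh) := by
    intro c hc
    obtain ⟨j, hj, h1, h2⟩ := (hXmem _ (hx c hc).1).2
    refine ⟨j, hj, fun y hy => ⟨h1.le.trans hy.1, hy.2.trans_lt ?_⟩⟩
    linarith
  have hAI : ∀ c ∈ C, A c ⊆ Set.Icc u (u + L) := by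
    intro c hc
    obtain ⟨j, hj, h⟩ := hAG c hc
    exact fun y hy => ⟨(hG j hj).2.1.trans (h hy).1, (h hy).2.le.trans (hG j hj).2.2.1⟩
  have hdD : ∀ c ∈ C, ∀ i, (U i ∩ A c).Nonempty → d i ≤ mesh := by
    intro c hc i hi
    obtain ⟨j, hj, h⟩ := hAG c hc
    exact ((hG j hj).2.2.2 i (hi.mono (Set.inter_subset_inter_right _ h))).le
  have hF1 : F ≤ 1 / 16 := by
    have := Real.rpow_le_one hL.le hL1 hs0.le
    linarith
  have hmany : 8 * F * mesh ^ (1 - s) ≤ #C * ρ := by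
    refine le_trans ?_ hK
    rw [hmeshpow, inv_eq_one_div]
    have h1 : 1 / t ^ 8 ≤ 1 / t ^ 7 :=
      one_div_le_one_div_of_le (by positivity) (pow_le_pow_right₀ (by linarith) (by norm_num))
    have h2 : 0 < 1 / t ^ 8 := by positivity
    nlinarith
  obtain ⟨c, hc, hle⟩ := hU.exists_hitWeight_le hs1 ρ mesh hρ0 hmesh0 C hCne A
    (Set.Icc u (u + L)) hAcell hAI hdD hmany
  have hxc := mem_reducedFractions.1 (hXmem _ (hx c hc).1).1
  have hI := hAI c hc
  rw [hA, Set.Icc_subset_Icc_iff (by linarith)] at hI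
  refine ⟨(x c).1, hxc.1, (x c).2, hxc.2.1.1, hxc.2.1.2, hxc.2.2, hI.1, hI.2, hle.trans ?_⟩
  have hρs : ρ ^ (1 - s) ≤ (t ^ 16)⁻¹ := by
    rw [← hNt', Real.rpow_neg hN0.le, ← Real.inv_rpow hN0.le, ← one_div]
    exact Real.rpow_le_rpow hρ0.le hρN (by linarith)
  have hCinv : 1 / (#C : ℝ) ≤ t ^ 7 * ρ := by
    rw [div_le_iff₀ hC0]
    rw [div_le_iff₀ (by positivity)] at hK
    linarith
  calc 8 * F / #C = 8 * F * (1 / #C) := by ring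
    _ ≤ 8 * (1 / 16) * (t ^ 7 * ρ) :=
        mul_le_mul (by linarith) hCinv (one_div_nonneg.2 hC0.le) (by norm_num)
    _ = t ^ 7 * ρ / 2 := by ring
    _ ≤ _ := pow_mul_le_rpow_div hs1 ht10 hρ0 hρs

open Finset in
theorem exists_child (ψ : ℕ → ℝ)
    (hdiv : Filter.Tendsto (fun N : ℕ => ∑ n ∈ Icc 1 N, ψ n) Filter.atTop Filter.atTop)
    {s : ℝ} {U : ℕ → Set ℝ} {d : ℕ → ℝ}
    (hU : WeightedCover s U d) (hs0 : 0 < s) (hs1 : s < 1)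
    (u L : ℝ) (hu : 0 ≤ u) (hL : 0 < L) (huL : u + L ≤ 1)
    (hF : hitWeight U (fun i => d i ^ s) (Set.Icc u (u + L)) ≤ L ^ s / 16) (m : ℕ) :
    ∃ n ≥ m, ∃ u' L' : ℝ, 0 < L' ∧ L' ≤ 1 / (m + 1) ∧ u ≤ u' ∧ u' + L' ≤ u + L ∧
      hitWeight U (fun i => d i ^ s) (Set.Icc u' (u' + L')) ≤ L' ^ s / 16 ∧
      ∀ x ∈ Set.Icc u' (u' + L'), (x : UnitAddCircle) ∈ E ψ n := by
  set δ := (1 - s) / 16 with hδ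
  have hδ0 : 0 < δ := by rw [hδ]; linarith
  obtain ⟨C, hC0, hC⟩ := exists_two_pow_card_primeFactors_le hδ0
  obtain ⟨N₀, hN₀⟩ := Filter.eventually_atTop.1 (eventually_scale_bounds hδ0 C L hL)
  -- Taking `N ≥ m + 1` yields both `n ≥ m` and `L' ≤ 1 / (m + 1)`.
  obtain ⟨N, hNm, hN1, Q, hne, hQ, hψ⟩ := exists_finset_large_values ψ hdiv hδ0 (max N₀ (m + 1))
  obtain ⟨h10, h16, h2C⟩ := hN₀ N ((le_max_left _ _).trans hNm)
  have hmN : m + 1 ≤ N := (le_max_right _ _).trans hNm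
  have hN0 : (0 : ℝ) < N := by exact_mod_cast hN1
  have hQ1 : (1 : ℝ) ≤ #Q := by exact_mod_cast hne.card_pos
  set t := (N : ℝ) ^ δ with ht
  have hω : ∀ q ∈ Q, (2 : ℝ) ^ #q.primeFactors ≤ t ^ 2 := by
    intro q hq
    have hq' := mem_Ico.1 (hQ hq)
    have hq2 : (q : ℝ) ≤ 2 * N := by exact_mod_cast hq'.2.le
    calc (2 : ℝ) ^ #q.primeFactors ≤ C * (q : ℝ) ^ δ := hC q (by omega)
      _ ≤ C * (2 * N) ^ δ := by gcongr
      _ = C * 2 ^ δ * t := by rw [Real.mul_rpow (by norm_num) hN0.le, mul_assoc]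
      _ ≤ t * t := by gcongr
      _ = t ^ 2 := by ring
  obtain ⟨q, hq, a, ha1, haq, hcop, hua, haL, hle⟩ :=
    exists_child_of_large_values hU hs0 hs1 u L hu hL huL hF N hN1 t ht h10 h16 Q hQ hne hω
  have hq' := mem_Ico.1 (hQ hq)
  have hq0 : (0 : ℝ) < q := by exact_mod_cast (show 0 < q by omega)
  have ht0 : 0 < t := by linarith
  have hρ0 : (0 : ℝ) < 1 / (#Q * N) := by positivity
  refine ⟨q, by omega, (a : ℝ) / q, 1 / (#Q * N) / (2 * t), by positivity, ?_, hua, haL, hle, ?_⟩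
  · have h1 : (m : ℝ) + 1 ≤ N := by exact_mod_cast hmN
    rw [div_div]
    refine one_div_le_one_div_of_le (by positivity) (h1.trans ?_)
    have h2 : (N : ℝ) ≤ #Q * N := by nlinarith
    nlinarith
  · intro x hx
    have h1 := hψ q hq
    have h2 : 1 / (#Q * N : ℝ) / (2 * t) < ψ q / q := by
      refine lt_of_lt_of_le ?_ h1
      rw [div_div]
      refine one_div_lt_one_div_of_lt (by positivity) ?_
      have : (0 : ℝ) < #Q * N := by positivity
      nlinarith
    have h3 : 0 < ψ q / q := lt_trans (by positivity) h2
    simp only [E, Set.mem_iUnion]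
    refine ⟨a, ⟨ha1, haq, hcop⟩, x, ⟨?_, ?_⟩, rfl⟩
    · rw [sub_div]; linarith [hx.1]
    · rw [add_div]; linarith [hx.2]

/-! ### Nested intervals and Hausdorff dimension -/

open MeasureTheory Measure
open scoped ENNReal NNReal

theorem exists_mem_W_of_weightedCover (ψ : ℕ → ℝ)
    (hdiv : Filter.Tendsto (fun N : ℕ => ∑ n ∈ Finset.Icc 1 N, ψ n) Filter.atTop Filter.atTop)
    {s : ℝ} {U : ℕ → Set ℝ} {d : ℕ → ℝ} (hU : WeightedCover s U d) (hs0 : 0 < s) (hs1 : s < 1)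
    (hsum : ∑' i, d i ^ s ≤ (1 / 2 : ℝ) ^ s / 16) :
    ∃ x ∈ Set.Icc (0 : ℝ) (1 / 2), (x : UnitAddCircle) ∈ W ψ ∧ ∀ i, x ∉ U i := by
  let Good : ℝ × ℝ → Prop := fun p => 0 ≤ p.1 ∧ 0 < p.2 ∧ p.1 + p.2 ≤ 1 ∧
    hitWeight U (fun i => d i ^ s) (Set.Icc p.1 (p.1 + p.2)) ≤ p.2 ^ s / 16
  have hstep : ∀ (m : ℕ) (p : {p // Good p}), ∃ p' : {p // Good p}, ∃ n ≥ m,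
      p'.1.2 ≤ 1 / (m + 1) ∧ p.1.1 ≤ p'.1.1 ∧ p'.1.1 + p'.1.2 ≤ p.1.1 + p.1.2 ∧
      ∀ x ∈ Set.Icc p'.1.1 (p'.1.1 + p'.1.2), (x : UnitAddCircle) ∈ E ψ n := by
    rintro m ⟨⟨u, L⟩, hu, hL, huL, hF⟩
    obtain ⟨n, hn, u', L', h1, h2, h3, h4, h5, h6⟩ :=
      exists_child ψ hdiv hU hs0 hs1 u L hu hL huL hF m
    exact ⟨⟨(u', L'), hu.trans h3, h1, h4.trans huL, h5⟩, n, hn, h2, h3, h4, h6⟩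
  choose next hnext using hstep
  have h0 : Good (0, 1 / 2) := by
    refine ⟨le_rfl, by norm_num, by norm_num, ?_⟩
    exact (hitWeight_le_tsum hU.weight_nonneg hU.summable).trans hsum
  let P : ℕ → {p // Good p} := fun k => Nat.rec ⟨(0, 1 / 2), h0⟩ (fun m p => next m p) k
  have hP : ∀ k, P (k + 1) = next k (P k) := fun k => rfl
  let I : ℕ → Set ℝ := fun k => Set.Icc (P k).1.1 ((P k).1.1 + (P k).1.2)
  have hsucc : ∀ k, I (k + 1) ⊆ I k := by
    intro k
    obtain ⟨n, -, -, h1, h2, -⟩ := hnext k (P k)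
    rw [← hP] at h1 h2
    exact Set.Icc_subset_Icc h1 h2
  have hanti : Antitone I := antitone_nat_of_succ_le hsucc
  obtain ⟨x, hx⟩ := IsCompact.nonempty_iInter_of_sequence_nonempty_isCompact_isClosed I hsucc
    (fun k => Set.nonempty_Icc.2 (by linarith [(P k).2.2.1])) isCompact_Icc
    (fun k => isClosed_Icc)
  rw [Set.mem_iInter] at hx
  refine ⟨x, ?_, ?_, fun i hi => ?_⟩
  · have := hx 0
    simpa [I, P] using this
  · simp only [W, Set.mem_iInter, Set.mem_iUnion]
    intro m _
    obtain ⟨n, hn, -, -, -, h⟩ := hnext m (P m)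
    refine ⟨n, hn, h x ?_⟩
    rw [← hP]
    exact hx (m + 1)
  -- A cover set containing `x` meets every interval, so `d i` is bounded by all their lengths,
  -- contradicting `0 < d i`.
  · have hle : ∀ k : ℕ, d i ≤ 1 / ((k : ℝ) + 1) := by
      intro k
      obtain ⟨n, -, h1, -⟩ := hnext k (P k)
      rw [← hP] at h1
      obtain ⟨-, h2, -, h3⟩ := (P (k + 1)).2
      refine le_trans (hU.le_of_hitWeight_le hs0 h2.le (h3.trans ?_) ⟨x, hi, hx (k + 1)⟩) h1
      have := Real.rpow_nonneg h2.le s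
      linarith
    have := ge_of_tendsto' tendsto_one_div_add_atTop_nhds_zero_nat hle
    exact absurd (hU.pos i) (not_lt.2 this)

theorem dist_coe_unitAddCircle {x y : ℝ} (hx : x ∈ Set.Icc (0 : ℝ) (1 / 2))
    (hy : y ∈ Set.Icc (0 : ℝ) (1 / 2)) :
    dist (x : UnitAddCircle) (y : UnitAddCircle) = |x - y| := by
  rw [dist_eq_norm, ← AddCircle.coe_sub, AddCircle.norm_coe_eq_abs_iff 1 one_ne_zero, abs_one,
    abs_le]
  constructor <;> linarith [hx.1, hx.2, hy.1, hy.2]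

theorem hausdorffMeasure_W_ne_zero (ψ : ℕ → ℝ)
    (hdiv : Filter.Tendsto (fun N : ℕ => ∑ n ∈ Finset.Icc 1 N, ψ n) Filter.atTop Filter.atTop)
    {s : ℝ} (hs0 : 0 < s) (hs1 : s < 1) : μH[s] (W ψ) ≠ 0 := by
  intro h
  set c : ℝ := (1 / 2 : ℝ) ^ s / 16 with hc
  have hc0 : 0 < c := by positivity
  rw [hausdorffMeasure_apply] at h
  simp only [ENNReal.iSup_eq_zero] at h
  have h1 := h 1 one_pos
  have h2 : (⨅ (t : ℕ → Set UnitAddCircle) (_ : W ψ ⊆ ⋃ n, t n)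
      (_ : ∀ n, Metric.ediam (t n) ≤ 1), ∑' n, ⨆ _ : (t n).Nonempty, Metric.ediam (t n) ^ s) <
      ENNReal.ofReal (c / 2) := by
    rw [h1]; exact ENNReal.ofReal_pos.2 (by positivity)
  simp only [iInf_lt_iff] at h2
  obtain ⟨t, hcov, hdiam, hlt⟩ := h2
  have hterm : ∀ n, (⨆ _ : (t n).Nonempty, Metric.ediam (t n) ^ s) = Metric.ediam (t n) ^ s := by
    intro n
    rcases (t n).eq_empty_or_nonempty with he | hne
    · simp [he, hs0]
    · simp [hne]
  simp only [hterm] at hlt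
  have hfin : ∀ n, Metric.ediam (t n) ≠ ∞ := fun n => ne_top_of_le_ne_top ENNReal.one_ne_top (hdiam n)
  set e : ℕ → ℝ := fun n => (Metric.ediam (t n)).toReal with he
  have he0 : ∀ n, 0 ≤ e n := fun n => ENNReal.toReal_nonneg
  have hes : ∀ n, e n ^ s = (Metric.ediam (t n) ^ s).toReal := fun n => ENNReal.toReal_rpow _ _
  have hesum : Summable fun n => e n ^ s := by
    simp_rw [hes]
    exact ENNReal.summable_toReal hlt.ne_top
  have hele : ∑' n, e n ^ s ≤ c / 2 := by
    simp_rw [hes]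
    rw [← ENNReal.tsum_toReal_eq fun n => ENNReal.rpow_ne_top_of_nonneg hs0.le (hfin n)]
    exact ENNReal.toReal_le_of_le_ofReal (by positivity) hlt.le
  -- Cover sets may have diameter zero, while `WeightedCover` needs `d i > 0`. The geometric padding
  -- has total `c / 2`, keeping the total weight at most `c`.
  set d : ℕ → ℝ := fun n => (e n ^ s + c / 2 / 2 / 2 ^ n) ^ s⁻¹ with hd
  have hpos : ∀ n, 0 < e n ^ s + c / 2 / 2 / 2 ^ n := fun n => by
    have := Real.rpow_nonneg (he0 n) s
    positivity
  have hds : ∀ n, d n ^ s = e n ^ s + c / 2 / 2 / 2 ^ n := fun n =>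
    Real.rpow_inv_rpow (hpos n).le hs0.ne'
  have hed : ∀ n, e n ≤ d n := by
    intro n
    rw [← Real.rpow_le_rpow_iff (he0 n) (Real.rpow_nonneg (hpos n).le _) hs0, hds]
    have : 0 < c / 2 / 2 / 2 ^ n := by positivity
    linarith
  -- On `[0, 1/2]` the projection to the circle is isometric, so lifting there preserves diameter
  -- bounds.
  set U : ℕ → Set ℝ := fun n => {x | x ∈ Set.Icc (0 : ℝ) (1 / 2) ∧ (x : UnitAddCircle) ∈ t n}
    with hUdef
  have hU : WeightedCover s U d := by
    refine ⟨fun n => Real.rpow_pos_of_pos (hpos n) _, ?_, fun n x hx y hy => ?_⟩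
    · simp_rw [hds]
      exact hesum.add (summable_geometric_two' (c / 2))
    · rw [← dist_coe_unitAddCircle hx.1 hy.1]
      refine le_trans ?_ (hed n)
      rw [dist_edist]
      exact ENNReal.toReal_mono (hfin n) (Metric.edist_le_ediam_of_mem hx.2 hy.2)
  obtain ⟨x, hx, hxW, hxU⟩ := exists_mem_W_of_weightedCover ψ hdiv hU hs0 hs1 (by
    simp_rw [hds]
    rw [hesum.tsum_add (summable_geometric_two' (c / 2)), tsum_geometric_two' (c / 2)]
    linarith)
  obtain ⟨n, hn⟩ := Set.mem_iUnion.1 (hcov hxW)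
  exact hxU n ⟨hx, hn⟩

theorem dimH_unitAddCircle_le (S : Set UnitAddCircle) : dimH S ≤ 1 := by
  have hlip : LipschitzWith 1 (fun x : ℝ => (x : UnitAddCircle)) := by
    refine LipschitzWith.of_dist_le_mul fun x y => ?_
    rw [dist_eq_norm, ← AddCircle.coe_sub, NNReal.coe_one, one_mul, Real.dist_eq,
      UnitAddCircle.norm_eq]
    simpa using round_le (x - y) 0
  calc dimH S ≤ dimH (Set.range fun x : ℝ => (x : UnitAddCircle)) :=
        dimH_mono fun x _ => QuotientAddGroup.mk_surjective x
    _ ≤ dimH (Set.univ : Set ℝ) := hlip.dimH_range_le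
    _ = 1 := Real.dimH_univ

end DuffinSchaeffer

theorem corollary2 (ψ : ℕ → ℝ) (hψ : ∀ n : ℕ, 1 ≤ n → 0 ≤ ψ n)
    (hdiv : Filter.Tendsto (fun N : ℕ => ∑ n ∈ Finset.Icc 1 N, ψ n) Filter.atTop Filter.atTop) :
    dimH (DuffinSchaeffer.W ψ) = 1 := by
  refine le_antisymm (DuffinSchaeffer.dimH_unitAddCircle_le _) ?_
  refine le_of_forall_lt fun b hb => ?_
  obtain ⟨s, hbs, hs1⟩ := ENNReal.lt_iff_exists_nnreal_btwn.1 hb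
  refine hbs.trans_le (le_dimH_of_hausdorffMeasure_ne_zero
    (DuffinSchaeffer.hausdorffMeasure_W_ne_zero ψ hdiv ?_ ?_))
  · exact_mod_cast (zero_le.trans_lt hbs)
  · exact_mod_cast hs1
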